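/- Let $\Omega\subset\mathbb R^3$ be a nonempty, open, connected, bounded set with Lipschitz boundary $\Gamma=\partial\Omega$ and unit outward normal $\mathbf n$, and let $\omega>0$. Write $(\mathbf a,\mathbf b)_\Omega=\int_\Omega \mathbf a\cdot\overline{\mathbf b}\,dx$. Let $\gamma^T\mathbf u=(\mathbf u\times\mathbf n)|_\Gamma$ be the tangential trace, defined on $\mathbf H(\mathrm{curl},\Omega)$ by the relation $(\mathbf u,\mathrm{curl}\,\varphi)_\Omega-(\mathrm{curl}\,\mathbf u,\varphi)_\Omega=\langle\gamma^T\mathbf u,\varphi\rangle_\Gamma$ for smooth $\varphi$. Let $\mathbf L^2_t(\Gamma)$ be the space of square-integrable tangential complex fields on $\Gamma$, and let $$\mathbf H^+(\mathrm{curl},\Omega)=\{\mathbf u\in \mathbf L^2(\Omega):\ \mathrm{curl}\,\mathbf u\in \mathbf L^2(\Omega),\ \gamma^T\mathbf u\in \mathbf L^2_t(\Gamma)\},$$ $$\|\mathbf u\|_{\mathbf H^+(\mathrm{curl},\Omega)}^2=\|\mathbf u\|_{\mathbf L^2(\Omega)}^2+\|\mathrm{curl}\,\mathbf u\|_{\mathbf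 L^2(\Omega)}^2+\|\gamma^T\mathbf u\|_{\mathbf L^2(\Gamma)}^2 .$$ For an essentially bounded field $\xi$ of complex tensors, a pair $(\theta,c)$ with $\theta\in\mathbb R$, $c>0$ is called admissible for $\xi$ if, for almost every $x$, $\Re\{e^{i\theta}(\xi(x) z)\cdot\overline z\}\ge c|z|^2$ for all complex vectors $z$ on which $\xi(x)$ acts. The angle $\theta$ is an ellipticity direction of $\xi$ if $(\theta,c)$ is admissible for some $c>0$, and $\xi$ is elliptic if it has an ellipticity direction. Let $\varepsilon,\mu\in L^\infty(\Omega)$ be elliptic fields of complex $3\times3$ tensors, let $\alpha\in L^\infty_t(\Gamma)$ be an elliptic field of complex $2\times 2$ tensors acting in the tangent planes of $\Gamma$, and put $\mu_+=\|\mu\|_{L^\infty(\Omega)}$. For $\mathbf u,\mathbf v\in\mathbf H^+(\mathrm{curl},\Omega)$ let $$a_R(\mathbf u,\mathbf v)=(\mu^{-1}\mathrm{curl}\,\mathbf u,\mathrm{curl}\,\mathbf v)_\Omega-\omega^2(\varepsilon\mathbf u,\mathbf v)_\Omega-\int_\Gamma(\alpha\,\gamma^T\mathbf u)\cdot\overline{\gamma^T\mathbf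 v}\,d\sigma .$$ Let $\theta\in\mathbb R$ be a common ellipticity direction of $\varepsilon$, $-\mu^{-1}$ and $\alpha$. Then there are constants $\varepsilon_-,\mu_-,\alpha_->0$ such that $(\theta,\varepsilon_-)$ is admissible for $\varepsilon$, $(\pi-\theta,\mu_-)$ for $\mu$, and $(\theta,\alpha_-)$ for $\alpha$. Moreover, for any such constants, $a_R$ is a sesquilinear form on $\mathbf H^+(\mathrm{curl},\Omega)$ that is coercive in the direction $\theta$ with constant $C=\min(\mu_-\mu_+^{-2},\ \omega^2\varepsilon_-,\ \alpha_-)>0$, that is, $$\Re\{-e^{i\theta}a_R(\mathbf u,\mathbf u)\}\ \ge\ C\,\|\mathbf u\|_{\mathbf H^+(\mathrm{curl},\Omega)}^2\qquad\text{for all }\mathbf u\in\mathbf H^+(\mathrm{curl},\Omega).$$ -/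

import Mathlib

open MeasureTheory Filter Topology
open scoped NNReal ENNReal

noncomputable section

/-- Physical space `ℝ³` with the Euclidean norm. -/
abbrev R3 : Type := EuclideanSpace ℝ (Fin 3)

/-- Complex vectors `ℂ³` with the Hermitian norm; `inner ℂ b a` is `a · conj b`. -/
abbrev C3 : Type := EuclideanSpace ℂ (Fin 3)

/-- Complex 3-by-3 tensors, with the operator norm `sup |ξ z| / |z|`. -/
abbrev Tensor3 : Type := C3 →L[ℂ] C3

/-- A real vector seen as a complex vector. -/
def R3.toC3 (x : R3) : C3 := WithLp.toLp 2 fun i => (x i : ℂ)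

/-! ### Lipschitz domains, surface measure, outward normal -/

/-- Bounded domains of `ℝ³` (open, connected, nonempty) with Lipschitz-continuous boundary: near
each boundary point, in suitable orthonormal coordinates, the set is the part of space lying
strictly below the graph of a Lipschitz function of two variables. -/
structure LipschitzDomain where
  /-- The underlying set. -/
  carrier : Set R3
  isOpen : IsOpen carrier
  isConnected : IsConnected carrier
  isBounded : Bornology.IsBounded carrier
  lipschitz_boundary : ∀ x ∈ frontier carrier,
    ∃ (R : R3 ≃ₗᵢ[ℝ] R3) (f : EuclideanSpace ℝ (Fin 2) → ℝ) (K : ℝ≥0), LipschitzWith K f ∧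
      ∀ᶠ y in 𝓝 x, (y ∈ carrier ↔ R y 2 < f !₂[R y 0, R y 1])

namespace LipschitzDomain

variable (Ω : LipschitzDomain)

/-- Lebesgue measure on `Ω`. -/
def vol : Measure R3 := volume.restrict Ω.carrier

/-- The boundary `Γ = ∂Ω`. -/
def boundary : Set R3 := frontier Ω.carrier

/-- The surface measure on `Γ`: the two-dimensional Hausdorff measure, normalized so that it is
the area on planes, restricted to `Γ`. -/
def surfaceMeasure : Measure R3 := (μHE[2] : Measure R3).restrict Ω.boundary

/-- `ν` is the unit outward normal to `Ω` at `x`: every open cone around `-ν` with vertex `x` and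
aperture less than a half-space is inside `Ω` near `x`, and every such cone around `ν` is outside.
In a Lipschitz domain this holds at the boundary points where the local graph is differentiable,
hence almost everywhere on `Γ`, and `ν` is then the usual normal. -/
def IsOutwardNormal (x ν : R3) : Prop :=
  ‖ν‖ = 1 ∧ ∀ δ > 0, ∀ᶠ y in 𝓝 x,
    (inner ℝ ν (y - x) < -δ * ‖y - x‖ → y ∈ Ω.carrier) ∧
    (inner ℝ ν (y - x) > δ * ‖y - x‖ → y ∉ Ω.carrier)

open Classical in
/-- The unit outward normal field `n` (extended by zero where there is no normal). -/
def normal (x : R3) : R3 := if h : ∃ ν, Ω.IsOutwardNormal x ν then h.choose else 0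

/-- The complex vector `z` is tangent to `Γ` at `x`: `z · n(x) = 0`. -/
def IsTangentAt (x : R3) (z : C3) : Prop := inner ℂ (Ω.normal x).toC3 z = 0

/-- The area of the boundary is finite. -/
instance : IsFiniteMeasure Ω.surfaceMeasure := by
  constructor
  rw [surfaceMeasure, Measure.restrict_apply_univ]
  have hcpt : IsCompact Ω.boundary :=
    Metric.isCompact_of_isClosed_isBounded isClosed_frontier
      (Ω.isBounded.closure.subset frontier_subset_closure)
  refine hcpt.measure_lt_top_of_nhdsWithin fun x hx => ?_
  obtain ⟨R, f, K, hf, hev⟩ := Ω.lipschitz_boundary x hx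
  let P : R3 → EuclideanSpace ℝ (Fin 2) := fun y => !₂[R y 0, R y 1]
  have hP : Continuous P := by
    refine (PiLp.continuous_toLp 2 _).comp (continuous_pi fun i => ?_)
    fin_cases i <;> simp <;> fun_prop
  have hR2 : Continuous fun y : R3 => R y 2 := by fun_prop
  have hfP : Continuous fun y : R3 => f (P y) := hf.continuous.comp hP
  -- frontier points near `x` lie on the graph
  have hgraph : ∀ᶠ y in 𝓝 x, y ∈ Ω.boundary → R y 2 = f (P y) := by
    filter_upwards [hev.eventually_nhds] with y hy hyΓ
    rw [boundary, Ω.isOpen.frontier_eq] at hyΓ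
    refine le_antisymm ?_ ?_
    · by_contra hlt
      push Not at hlt
      have h1 : ∀ᶠ w in 𝓝 y, f (P w) < R w 2 :=
        hfP.continuousAt.eventually_lt hR2.continuousAt hlt
      have h2 : ∀ᶠ w in 𝓝 y, w ∉ Ω.carrier := by
        filter_upwards [h1, hy] with w hw1 hw2 hw
        exact absurd (hw2.1 hw) (not_lt.2 hw1.le)
      exact (mem_closure_iff_frequently.1 hyΓ.1) h2
    · by_contra hlt
      push Not at hlt
      exact hyΓ.2 (hy.self_of_nhds.2 hlt)
  let G : EuclideanSpace ℝ (Fin 2) → R3 := fun p => R.symm !₂[p 0, p 1, f p]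
  obtain ⟨L, hG⟩ : ∃ L : ℝ≥0, LipschitzWith L G := by
    refine ⟨_, R.symm.lipschitz.comp ((PiLp.lipschitzWith_toLp 2 _).comp
      (LipschitzWith.of_dist_le_mul (K := 1 + K) fun p q => ?_))⟩
    rw [dist_pi_le_iff (by positivity)]
    have hc : ∀ i, dist (p i) (q i) ≤ dist p q := fun i => by
      simpa [dist_eq_norm] using PiLp.norm_apply_le (p - q) i
    have hd : (0 : ℝ) ≤ dist p q := dist_nonneg
    have hK : (0 : ℝ) ≤ K * dist p q := by positivity
    have hfd := hf.dist_le_mul p q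
    intro i
    have h0 := hc 0
    have h1 := hc 1
    fin_cases i
    · simp only [NNReal.coe_add, NNReal.coe_one]; simp; nlinarith
    · simp only [NNReal.coe_add, NNReal.coe_one]; simp; nlinarith
    · simp only [NNReal.coe_add, NNReal.coe_one]; simp; nlinarith
  have hGP : ∀ y, R y 2 = f (P y) → G (P y) = y := by
    intro y hy
    apply R.injective
    simp only [G, LinearIsometryEquiv.apply_symm_apply]
    ext i
    fin_cases i
    · simp [P]
    · simp [P]
    · simp [hy]
  have hball : ∀ᶠ y in 𝓝 x, P y ∈ Metric.closedBall (P x) 1 :=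
    hP.continuousAt.eventually (Metric.closedBall_mem_nhds _ one_pos)
  refine ⟨{y | y ∈ Ω.boundary ∧ R y 2 = f (P y) ∧ P y ∈ Metric.closedBall (P x) 1}, ?_, ?_⟩
  · rw [mem_nhdsWithin_iff_eventually]
    filter_upwards [hgraph, hball] with y h1 h2 h3
    exact ⟨h3, h1 h3, h2⟩
  · have hsub : {y | y ∈ Ω.boundary ∧ R y 2 = f (P y) ∧ P y ∈ Metric.closedBall (P x) 1} ⊆
        G '' Metric.closedBall (P x) 1 := fun y hy => ⟨P y, hy.2.2, hGP y hy.2.1⟩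
    refine (measure_mono hsub).trans_lt ?_
    have h1 := hG.hausdorffMeasure_image_le (d := 2) (by norm_num) (Metric.closedBall (P x) 1)
    rw [Measure.euclideanHausdorffMeasure_def, Measure.smul_apply]
    have hfin : (μH[2] : Measure (EuclideanSpace ℝ (Fin 2))) (Metric.closedBall (P x) 1) < ⊤ := by
      have : (μH[((2 : ℕ) : ℝ)] : Measure (EuclideanSpace ℝ (Fin 2)))
          (Metric.closedBall (P x) 1) < ⊤ := (isCompact_closedBall _ _).measure_lt_top
      simpa using this
    have h2 : (μH[((2 : ℕ) : ℝ)] : Measure R3) (G '' Metric.closedBall (P x) 1) < ⊤ := by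
      have := h1.trans_lt (ENNReal.mul_lt_top (by simp) hfin)
      simpa using this
    exact ENNReal.mul_lt_top ENNReal.coe_lt_top h2

/-! ### The spaces `H(curl, Ω)` and `H⁺(curl, Ω)` -/

/-- `L²(Ω)`, complex vector-valued. -/
abbrev L2 : Type := Lp C3 2 Ω.vol

/-- `L²(Γ)`, complex vector-valued. -/
abbrev L2Boundary : Type := Lp C3 2 Ω.surfaceMeasure

/-- `L²_t(Γ)`: the square-integrable tangential fields on `Γ`. -/
def L2Tangential : Submodule ℂ Ω.L2Boundary where
  carrier := {g | ∀ᵐ x ∂Ω.surfaceMeasure, Ω.IsTangentAt x (g x)}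
  zero_mem' := by
    have h : ∀ᵐ x ∂Ω.surfaceMeasure, Ω.IsTangentAt x ((0 : Ω.L2Boundary) x) := by
      filter_upwards [Lp.coeFn_zero C3 2 Ω.surfaceMeasure] with x hx
      rw [IsTangentAt, hx, Pi.zero_apply, inner_zero_right]
    exact h
  add_mem' := by
    intro a b ha hb
    have h : ∀ᵐ x ∂Ω.surfaceMeasure, Ω.IsTangentAt x ((a + b : Ω.L2Boundary) x) := by
      filter_upwards [Lp.coeFn_add a b, ha, hb] with x hx h1 h2
      rw [IsTangentAt] at *
      rw [hx, Pi.add_apply, inner_add_right, h1, h2, add_zero]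
    exact h
  smul_mem' := by
    intro c a ha
    have h : ∀ᵐ x ∂Ω.surfaceMeasure, Ω.IsTangentAt x ((c • a : Ω.L2Boundary) x) := by
      filter_upwards [Lp.coeFn_smul c a, ha] with x hx h1
      rw [IsTangentAt] at *
      rw [hx, Pi.smul_apply, inner_smul_right, h1, mul_zero]
    exact h

end LipschitzDomain

/-- Smooth compactly supported fields `ℝ³ → ℂ³`. -/
def IsTestField (φ : R3 → C3) : Prop := ContDiff ℝ (⊤ : ℕ∞) φ ∧ HasCompactSupport φ

/-- The partial derivative `∂ᵢ φⱼ` at `x`. -/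
def pderivComp (φ : R3 → C3) (i j : Fin 3) (x : R3) : ℂ :=
  fderiv ℝ φ x (EuclideanSpace.single i 1) j

/-- The pointwise curl of a differentiable field. -/
def classicalCurl (φ : R3 → C3) (x : R3) : C3 :=
  !₂[pderivComp φ 1 2 x - pderivComp φ 2 1 x,
     pderivComp φ 2 0 x - pderivComp φ 0 2 x,
     pderivComp φ 0 1 x - pderivComp φ 1 0 x]

lemma IsTestField.continuous_classicalCurl {φ : R3 → C3} (hφ : IsTestField φ) :
    Continuous (classicalCurl φ) := by
  have h : Continuous (fderiv ℝ φ) := hφ.1.continuous_fderiv (by simp)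
  have h' : ∀ i j, Continuous (pderivComp φ i j) := fun i j => by
    unfold pderivComp
    fun_prop
  refine (PiLp.continuous_toLp 2 _).comp (continuous_pi fun i => ?_)
  fin_cases i <;> simp <;> exact (h' _ _).sub (h' _ _)

lemma IsTestField.hasCompactSupport_classicalCurl {φ : R3 → C3} (hφ : IsTestField φ) :
    HasCompactSupport (classicalCurl φ) := by
  refine (hφ.2.fderiv (𝕜 := ℝ)).mono fun x hx h0 => hx ?_
  have h0' : fderiv ℝ φ x = 0 := by simpa using h0
  ext i
  fin_cases i <;> simp [classicalCurl, pderivComp, h0']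

/-- The pairing of a square-integrable field with a bounded compactly supported continuous field
is integrable. -/
lemma integrable_inner_testField {m : Measure R3} [IsFiniteMeasureOnCompacts m] {ψ : R3 → C3}
    (hc : Continuous ψ) (hs : HasCompactSupport ψ) (u : Lp C3 2 m) :
    Integrable (fun x => inner ℂ (ψ x) (u x)) m := by
  have hψ : MemLp ψ 2 m := hc.memLp_of_hasCompactSupport hs
  refine (L2.integrable_inner (𝕜 := ℂ) (hψ.toLp ψ) u).congr ?_
  filter_upwards [hψ.coeFn_toLp] with x hx
  rw [hx]

/-- A square-integrable field that is orthogonal to all test fields supported in `U` vanishes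
almost everywhere in `U`. -/
lemma ae_eq_zero_of_forall_testField {m : Measure R3} [IsFiniteMeasureOnCompacts m]
    {U : Set R3} (hU : IsOpen U) (d : Lp C3 2 m)
    (h : ∀ φ, IsTestField φ → tsupport φ ⊆ U → ∫ x, inner ℂ (φ x) (d x) ∂m = 0) :
    ∀ᵐ x ∂m, x ∈ U → d x = 0 := by
  have hloc : LocallyIntegrable (fun x => d x) m := (Lp.memLp d).locallyIntegrable (by norm_num)
  have key : ∀ i : Fin 3, ∀ᵐ x ∂m, x ∈ U → d x i = 0 := by
    intro i
    have hlo : LocallyIntegrable (fun x => d x i) m := by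
      intro x
      obtain ⟨s, hs, hi⟩ := hloc x
      exact ⟨s, hs, (EuclideanSpace.proj (𝕜 := ℂ) i).integrable_comp hi⟩
    refine hU.ae_eq_zero_of_integral_contDiff_smul_eq_zero (hlo.locallyIntegrableOn U) ?_
    intro g hg hgs hgU
    have hsupp : Function.support (fun x => EuclideanSpace.single i ((g x : ℝ) : ℂ) : R3 → C3) ⊆
        Function.support g := by
      intro x hx h0
      apply hx
      simp only [h0]
      ext j
      simp
    have := h (fun x => EuclideanSpace.single i ((g x : ℝ) : ℂ)) ⟨?_, ?_⟩ ?_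
    · rw [← this]
      refine integral_congr_ae (Eventually.of_forall fun x => ?_)
      simp [EuclideanSpace.inner_single_left]
    · rw [contDiff_piLp]
      intro j
      by_cases hj : j = i
      · subst hj
        simp only [EuclideanSpace.single_apply, if_true]
        exact Complex.ofRealCLM.contDiff.comp hg
      · simp [hj, contDiff_const]
    · exact hgs.mono hsupp
    · exact (closure_mono hsupp).trans hgU
  filter_upwards [key 0, key 1, key 2] with x h0 h1 h2 hx
  ext i
  fin_cases i
  · simpa using h0 hx
  · simpa using h1 hx
  · simpa using h2 hx

namespace LipschitzDomain

variable (Ω : LipschitzDomain)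

instance : IsFiniteMeasureOnCompacts Ω.vol := by unfold vol; infer_instance

/-- `c = curl u` in `Ω` in the sense of distributions. -/
def IsWeakCurl (u c : Ω.L2) : Prop :=
  ∀ φ, IsTestField φ → tsupport φ ⊆ Ω.carrier →
    ∫ x, inner ℂ (classicalCurl φ x) (u x) ∂Ω.vol = ∫ x, inner ℂ (φ x) (c x) ∂Ω.vol

variable {Ω}

lemma integral_inner_add {m : Measure R3} [IsFiniteMeasureOnCompacts m] {ψ : R3 → C3}
    (hc : Continuous ψ) (hs : HasCompactSupport ψ) (u v : Lp C3 2 m) :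
    ∫ x, inner ℂ (ψ x) ((u + v : Lp C3 2 m) x) ∂m =
      ∫ x, inner ℂ (ψ x) (u x) ∂m + ∫ x, inner ℂ (ψ x) (v x) ∂m := by
  rw [← integral_add (integrable_inner_testField hc hs u) (integrable_inner_testField hc hs v)]
  refine integral_congr_ae ?_
  filter_upwards [Lp.coeFn_add u v] with x hx
  rw [hx, Pi.add_apply, inner_add_right]

lemma integral_inner_smul {m : Measure R3} (ψ : R3 → C3) (k : ℂ) (u : Lp C3 2 m) :
    ∫ x, inner ℂ (ψ x) ((k • u : Lp C3 2 m) x) ∂m = k * ∫ x, inner ℂ (ψ x) (u x) ∂m := by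
  rw [← integral_const_mul]
  refine integral_congr_ae ?_
  filter_upwards [Lp.coeFn_smul k u] with x hx
  rw [hx, Pi.smul_apply, inner_smul_right]

lemma integral_inner_zero {m : Measure R3} (ψ : R3 → C3) :
    ∫ x, inner ℂ (ψ x) ((0 : Lp C3 2 m) x) ∂m = 0 := by
  simpa using integral_inner_smul ψ 0 (0 : Lp C3 2 m)

lemma eq_of_integral_inner_eq {m : Measure R3} [IsFiniteMeasureOnCompacts m]
    {U : Set R3} (hU : IsOpen U) (hm : ∀ᵐ x ∂m, x ∈ U) (c d : Lp C3 2 m)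
    (h : ∀ φ, IsTestField φ → tsupport φ ⊆ U →
      ∫ x, inner ℂ (φ x) (c x) ∂m = ∫ x, inner ℂ (φ x) (d x) ∂m) : c = d := by
  rw [← sub_eq_zero]
  apply Lp.ext
  have := ae_eq_zero_of_forall_testField hU (c - d) fun φ hφ hφU => by
    have h1 := integral_inner_add hφ.1.continuous hφ.2 (c - d) d
    rw [sub_add_cancel, h φ hφ hφU] at h1
    simpa using h1
  filter_upwards [this, hm, Lp.coeFn_zero C3 2 m] with x h1 h2 h3
  rw [h1 h2, h3]
  rfl

/-- The weak curl is unique. -/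
lemma IsWeakCurl.unique {u c d : Ω.L2} (hc : Ω.IsWeakCurl u c) (hd : Ω.IsWeakCurl u d) : c = d :=
  eq_of_integral_inner_eq Ω.isOpen (ae_restrict_mem Ω.isOpen.measurableSet) c d
    fun φ hφ hφU => (hc φ hφ hφU).symm.trans (hd φ hφ hφU)

lemma IsWeakCurl.add {u v c d : Ω.L2} (hc : Ω.IsWeakCurl u c) (hd : Ω.IsWeakCurl v d) :
    Ω.IsWeakCurl (u + v) (c + d) := fun φ hφ hφU => by
  rw [integral_inner_add hφ.continuous_classicalCurl hφ.hasCompactSupport_classicalCurl,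
    integral_inner_add hφ.1.continuous hφ.2, hc φ hφ hφU, hd φ hφ hφU]

lemma IsWeakCurl.smul {u c : Ω.L2} (k : ℂ) (hc : Ω.IsWeakCurl u c) :
    Ω.IsWeakCurl (k • u) (k • c) := fun φ hφ hφU => by
  rw [integral_inner_smul, integral_inner_smul, hc φ hφ hφU]

variable (Ω)

/-- `H(curl, Ω)`: the fields of `L²(Ω)` whose distributional curl is in `L²(Ω)`. -/
def HCurl : Submodule ℂ Ω.L2 where
  carrier := {u | ∃ c, Ω.IsWeakCurl u c}
  zero_mem' := ⟨0, fun φ _ _ => by rw [integral_inner_zero, integral_inner_zero]⟩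
  add_mem' := fun ⟨c, hc⟩ ⟨d, hd⟩ => ⟨c + d, hc.add hd⟩
  smul_mem' := fun k _ ⟨c, hc⟩ => ⟨k • c, hc.smul k⟩

/-- The operator `curl : H(curl, Ω) → L²(Ω)`. -/
def curl : Ω.HCurl →ₗ[ℂ] Ω.L2 where
  toFun u := u.2.choose
  map_add' u v := (u + v).2.choose_spec.unique (u.2.choose_spec.add v.2.choose_spec)
  map_smul' k u := (k • u).2.choose_spec.unique (u.2.choose_spec.smul k)

/-- The tangential trace `γᵀ u = (u × n)|_Γ` of `u ∈ H(curl, Ω)`, as a functional on (traces of)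
smooth fields, given by the integration by parts relation
`⟨γᵀ u, φ⟩_Γ = (u, curl φ)_Ω - (curl u, φ)_Ω`. -/
def traceFunctional (u : Ω.HCurl) (φ : R3 → C3) : ℂ :=
  ∫ x, inner ℂ (classicalCurl φ x) (u.1 x) ∂Ω.vol - ∫ x, inner ℂ (φ x) (Ω.curl u x) ∂Ω.vol

/-- `γᵀ u` is the field `g ∈ L²_t(Γ)`: `⟨γᵀ u, φ⟩_Γ = ∫_Γ g · conj φ` for all smooth `φ`. -/
def HasTangentialTrace (u : Ω.HCurl) (g : Ω.L2Tangential) : Prop :=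
  ∀ φ, IsTestField φ →
    Ω.traceFunctional u φ = ∫ x, inner ℂ (φ x) (g.1 x) ∂Ω.surfaceMeasure

variable {Ω}

lemma HasTangentialTrace.unique {u : Ω.HCurl} {g h : Ω.L2Tangential}
    (hg : Ω.HasTangentialTrace u g) (hh : Ω.HasTangentialTrace u h) : g = h :=
  Subtype.ext <| eq_of_integral_inner_eq isOpen_univ (by simp) g.1 h.1
    fun φ hφ _ => (hg φ hφ).symm.trans (hh φ hφ)

lemma HasTangentialTrace.add {u v : Ω.HCurl} {g h : Ω.L2Tangential}
    (hg : Ω.HasTangentialTrace u g) (hh : Ω.HasTangentialTrace v h) :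
    Ω.HasTangentialTrace (u + v) (g + h) := fun φ hφ => by
  have h1 := hg φ hφ
  have h2 := hh φ hφ
  simp only [traceFunctional] at *
  rw [map_add, Submodule.coe_add, Submodule.coe_add,
    integral_inner_add hφ.continuous_classicalCurl hφ.hasCompactSupport_classicalCurl,
    integral_inner_add hφ.1.continuous hφ.2, integral_inner_add hφ.1.continuous hφ.2, ← h1, ← h2]
  ring

lemma HasTangentialTrace.smul {u : Ω.HCurl} {g : Ω.L2Tangential} (k : ℂ)
    (hg : Ω.HasTangentialTrace u g) : Ω.HasTangentialTrace (k • u) (k • g) := fun φ hφ => by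
  have h1 := hg φ hφ
  simp only [traceFunctional] at *
  rw [map_smul, Submodule.coe_smul, Submodule.coe_smul, integral_inner_smul, integral_inner_smul,
    integral_inner_smul, ← h1]
  ring

variable (Ω)

/-- `H⁺(curl, Ω)`: the fields of `H(curl, Ω)` whose tangential trace is in `L²_t(Γ)`. -/
def HPlus : Submodule ℂ Ω.HCurl where
  carrier := {u | ∃ g, Ω.HasTangentialTrace u g}
  zero_mem' := ⟨0, fun φ _ => by
    simp only [traceFunctional, map_zero, Submodule.coe_zero, integral_inner_zero, sub_zero]⟩
  add_mem' := fun ⟨g, hg⟩ ⟨h, hh⟩ => ⟨g + h, hg.add hh⟩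
  smul_mem' := fun k _ ⟨g, hg⟩ => ⟨k • g, hg.smul k⟩

/-- The tangential trace `γᵀ : H⁺(curl, Ω) → L²_t(Γ)`. -/
def tangentialTrace : Ω.HPlus →ₗ[ℂ] Ω.L2Tangential where
  toFun u := u.2.choose
  map_add' u v := (u + v).2.choose_spec.unique (u.2.choose_spec.add v.2.choose_spec)
  map_smul' k u := (k • u).2.choose_spec.unique (u.2.choose_spec.smul k)

/-- The norm of `H⁺(curl, Ω)`. -/
def hPlusNorm (u : Ω.HPlus) : ℝ :=
  √(‖u.1.1‖ ^ 2 + ‖Ω.curl u.1‖ ^ 2 + ‖Ω.tangentialTrace u‖ ^ 2)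

/-! ### Material fields -/

/-- The pair `(θ, c)` fulfils the ellipticity condition for the 3-by-3 tensor field `ξ` on `Ω`. -/
def EllipticWith (ξ : R3 → Tensor3) (θ c : ℝ) : Prop :=
  0 < c ∧ ∀ᵐ x ∂Ω.vol, ∀ z : C3,
    c * ‖z‖ ^ 2 ≤ (Complex.exp (Complex.I * θ) * inner ℂ z (ξ x z)).re

/-- `θ` is an ellipticity direction of `ξ`. -/
def IsEllipticityDirection (ξ : R3 → Tensor3) (θ : ℝ) : Prop := ∃ c, Ω.EllipticWith ξ θ c

/-- `ξ` is an elliptic tensor field of class `L^∞(Ω)`. -/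
def IsElliptic (ξ : R3 → Tensor3) : Prop :=
  MemLp ξ ⊤ Ω.vol ∧ ∃ θ, Ω.IsEllipticityDirection ξ θ

/-- `ξ₊`: the `L^∞(Ω)` norm of `ξ`. -/
def supNorm (ξ : R3 → Tensor3) : ℝ := (eLpNorm ξ ⊤ Ω.vol).toReal

/-- `α ∈ L_t^∞(Γ)`: an essentially bounded field of tensors acting in the tangent planes of `Γ`.
A 2-by-2 tensor on the tangent plane at `x` is represented by the 3-by-3 tensor that agrees with
it on the tangent plane and vanishes on the normal (as `I₂` is represented by `I₃ - n ⊗ n`). -/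
def IsTangentialTensorField (α : R3 → Tensor3) : Prop :=
  MemLp α ⊤ Ω.surfaceMeasure ∧ ∀ᵐ x ∂Ω.surfaceMeasure,
    α x (Ω.normal x).toC3 = 0 ∧ ∀ z, Ω.IsTangentAt x (α x z)

/-- The pair `(θ, c)` fulfils the ellipticity condition for the tangential tensor field `α`. -/
def TangentialEllipticWith (α : R3 → Tensor3) (θ c : ℝ) : Prop :=
  0 < c ∧ ∀ᵐ x ∂Ω.surfaceMeasure, ∀ z : C3, Ω.IsTangentAt x z →
    c * ‖z‖ ^ 2 ≤ (Complex.exp (Complex.I * θ) * inner ℂ z (α x z)).re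

/-- `θ` is an ellipticity direction of the tangential tensor field `α`. -/
def IsTangentialEllipticityDirection (α : R3 → Tensor3) (θ : ℝ) : Prop :=
  ∃ c, Ω.TangentialEllipticWith α θ c

/-- The Robin sesquilinear form
`a_R(u, v) = (μ⁻¹ curl u, curl v)_Ω - ω² (ε u, v)_Ω - ⟨α γᵀ u, γᵀ v⟩_Γ` on `H⁺(curl, Ω)`. -/
def robinForm (ω : ℝ) (ε μ α : R3 → Tensor3) (u v : Ω.HPlus) : ℂ :=
  ∫ x, inner ℂ (Ω.curl v.1 x) ((μ x).inverse (Ω.curl u.1 x)) ∂Ω.vol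
    - (ω : ℂ) ^ 2 * ∫ x, inner ℂ (v.1.1 x) (ε x (u.1.1 x)) ∂Ω.vol
    - ∫ x, inner ℂ ((Ω.tangentialTrace v).1 x) (α x ((Ω.tangentialTrace u).1 x))
        ∂Ω.surfaceMeasure

end LipschitzDomain

/-- `a` is a sesquilinear form: linear in its first argument, antilinear in the second. -/
structure IsSesquilinear {V : Type*} [AddCommGroup V] [Module ℂ V] (a : V → V → ℂ) : Prop where
  add_left : ∀ u u' v, a (u + u') v = a u v + a u' v
  smul_left : ∀ (k : ℂ) u v, a (k • u) v = k * a u v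
  add_right : ∀ u v v', a u (v + v') = a u v + a u v'
  smul_right : ∀ (k : ℂ) u v, a u (k • v) = (starRingEnd ℂ) k * a u v

/-- The form `a` on the space `V` with norm `N` is a sesquilinear form that is coercive in the
direction `θ` with coercivity constant `C`. -/
def IsCoerciveWith {V : Type*} [AddCommGroup V] [Module ℂ V] (N : V → ℝ) (a : V → V → ℂ)
    (θ C : ℝ) : Prop :=
  IsSesquilinear a ∧ 0 < C ∧
    ∀ u, C * N u ^ 2 ≤ (-(Complex.exp (Complex.I * θ) * a u u)).re

end

/-! ### Forms on `L²` with essentially bounded tensor coefficients. -/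

section TensorForm

variable {m : Measure R3} {A : R3 → Tensor3}

/-! Multiplying `a_R(u, u)` by `-e^{iθ}` turns all three terms into integrals of tensors elliptic in
the same direction `θ`: `-μ⁻¹` against `curl u`, `ω² ε` against `u`, `α` against the trace. Each
pointwise ellipticity bound integrates to a bound by an `L²` norm
(`mul_norm_sq_le_re_integral_tensor`), and the least of the three constants serves for the sum.

The real content is the passage between `μ` and `-μ⁻¹`. With `w = μ z`, the number `e^{iθ} (-μ⁻¹ w)
· conj w` is the complex conjugate of `e^{i(π-θ)} (μ z) · conj z`, so the two have the same real
part (`re_exp_mul_inner_neg_swap`). It remains to compare `|w|` with `|z|`. The bound `|w| ≤ μ₊ |z|`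
yields the constant `μ₋ / μ₊²` for `-μ⁻¹` (`EllipticWith.neg_inverse`). A lower bound `c' |z| ≤
|w|`, which follows from ellipticity of `μ` in any direction, yields an admissible constant for `μ`
(`EllipticWith.of_neg_inverse`). -/

lemma ae_norm_le_toReal_eLpNorm_top (hA : MemLp A ⊤ m) :
    ∀ᵐ x ∂m, ‖A x‖ ≤ (eLpNorm A ⊤ m).toReal := by
  filter_upwards [ae_le_eLpNormEssSup (f := A) (μ := m)] with x hx
  rw [← eLpNorm_exponent_top] at hx
  simpa using ENNReal.toReal_mono hA.2.ne hx

lemma memLp_tensor_apply (hA : MemLp A ⊤ m) (f : Lp C3 2 m) :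
    MemLp (fun x => A x (f x)) 2 m := by
  have hf := Lp.memLp f
  refine hf.of_le_mul (c := (eLpNorm A ⊤ m).toReal) ?_ ?_
  · exact (ContinuousLinearMap.apply ℂ C3 (E := C3)).flip.aestronglyMeasurable_comp₂
      hA.1 hf.1
  · filter_upwards [ae_norm_le_toReal_eLpNorm_top hA] with x hx
    exact (A x).le_of_opNorm_le hx _

lemma integrable_tensor_inner (hA : MemLp A ⊤ m) (f g : Lp C3 2 m) :
    Integrable (fun x => inner ℂ (g x) (A x (f x))) m := by
  have h := memLp_tensor_apply hA f
  refine (L2.integrable_inner (𝕜 := ℂ) g (h.toLp _)).congr ?_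
  filter_upwards [h.coeFn_toLp] with x hx
  rw [hx]

/-- The form `(f, g) ↦ ∫ (A f) · conj g` on `L²` is sesquilinear. -/
lemma isSesquilinear_tensor (hA : MemLp A ⊤ m) :
    IsSesquilinear fun f g : Lp C3 2 m => ∫ x, inner ℂ (g x) (A x (f x)) ∂m where
  add_left f f' g := by
    rw [← integral_add (integrable_tensor_inner hA f g) (integrable_tensor_inner hA f' g)]
    refine integral_congr_ae ?_
    filter_upwards [Lp.coeFn_add f f'] with x hx
    rw [hx, Pi.add_apply, map_add, inner_add_right]
  smul_left k f g := by
    rw [← integral_const_mul]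
    refine integral_congr_ae ?_
    filter_upwards [Lp.coeFn_smul k f] with x hx
    rw [hx, Pi.smul_apply, map_smul, inner_smul_right]
  add_right f g g' := by
    rw [← integral_add (integrable_tensor_inner hA f g) (integrable_tensor_inner hA f g')]
    refine integral_congr_ae ?_
    filter_upwards [Lp.coeFn_add g g'] with x hx
    rw [hx, Pi.add_apply, inner_add_left]
  smul_right k f g := by
    rw [← integral_const_mul]
    refine integral_congr_ae ?_
    filter_upwards [Lp.coeFn_smul k g] with x hx
    rw [hx, Pi.smul_apply, inner_smul_left]

/-- The bound is needed only along the values of `f`, not for all vectors, so the lemma also covers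
`α`, which is elliptic on tangent vectors alone. -/
lemma mul_norm_sq_le_re_integral_tensor (hA : MemLp A ⊤ m) (f : Lp C3 2 m) (w : ℂ) (c : ℝ)
    (h : ∀ᵐ x ∂m, c * ‖f x‖ ^ 2 ≤ (w * inner ℂ (f x) (A x (f x))).re) :
    c * ‖f‖ ^ 2 ≤ (w * ∫ x, inner ℂ (f x) (A x (f x)) ∂m).re := by
  have hint := (integrable_tensor_inner hA f f).const_mul w
  have hre : (w * ∫ x, inner ℂ (f x) (A x (f x)) ∂m).re =
      ∫ x, (w * inner ℂ (f x) (A x (f x))).re ∂m := by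
    rw [← integral_const_mul]
    exact (integral_re hint).symm
  have hn : ‖f‖ ^ 2 = ∫ x, ‖f x‖ ^ 2 ∂m := by
    rw [← inner_self_eq_norm_sq (𝕜 := ℂ) f, L2.inner_def, ← integral_re (L2.integrable_inner f f)]
    exact integral_congr_ae (Eventually.of_forall fun x => inner_self_eq_norm_sq (𝕜 := ℂ) (f x))
  rw [hre, hn, ← integral_const_mul]
  exact integral_mono_ae ((Lp.memLp f).integrable_norm_pow (by norm_num) |>.const_mul c)
    hint.re h

end TensorForm

/-! ### Pointwise ellipticity and inverses -/

lemma norm_exp_I_mul_ofReal (θ : ℝ) : ‖Complex.exp (Complex.I * θ)‖ = 1 := by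
  rw [mul_comm]
  exact Complex.norm_exp_ofReal_mul_I θ

/-- Passing from `T z` to `z` in an ellipticity condition reflects the direction. -/
lemma re_exp_mul_inner_neg_swap (θ : ℝ) (a b : C3) :
    (Complex.exp (Complex.I * θ) * inner ℂ a (-b)).re =
      (Complex.exp (Complex.I * ((Real.pi - θ : ℝ) : ℂ)) * inner ℂ b a).re := by
  have h : Complex.exp (Complex.I * ((Real.pi - θ : ℝ) : ℂ)) =
      -(starRingEnd ℂ) (Complex.exp (Complex.I * θ)) := by
    rw [← Complex.exp_conj]
    push_cast
    rw [mul_sub, mul_comm Complex.I (Real.pi : ℂ), sub_eq_add_neg, Complex.exp_add,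
      Complex.exp_pi_mul_I]
    simp
  rw [h, ← inner_conj_symm b a, neg_mul, ← map_mul, inner_neg_right, mul_neg, Complex.neg_re,
    Complex.neg_re, Complex.conj_re]

/-- Cauchy–Schwarz: the phase has modulus one, so `c |z|² ≤ |z| |T z|`, and one factor `|z|`
cancels. -/
lemma mul_norm_le_of_elliptic {T : Tensor3} {θ c : ℝ}
    (h : ∀ z : C3, c * ‖z‖ ^ 2 ≤ (Complex.exp (Complex.I * θ) * inner ℂ z (T z)).re) (z : C3) :
    c * ‖z‖ ≤ ‖T z‖ := by
  rcases eq_or_ne z 0 with rfl | hz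
  · simp
  have hpos : 0 < ‖z‖ := norm_pos_iff.2 hz
  have h1 : c * ‖z‖ ^ 2 ≤ ‖z‖ * ‖T z‖ := calc
    _ ≤ _ := h z
    _ ≤ ‖Complex.exp (Complex.I * θ) * inner ℂ z (T z)‖ := Complex.re_le_norm _
    _ ≤ ‖z‖ * ‖T z‖ := by
      rw [norm_mul, norm_exp_I_mul_ofReal, one_mul]
      exact norm_inner_le_norm z (T z)
  nlinarith

/-- The kernel is trivial, and an injective endomorphism of a finite-dimensional space is bijective.
-/
lemma isInvertible_of_mul_norm_le {T : Tensor3} {c : ℝ} (hc : 0 < c)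
    (h : ∀ z, c * ‖z‖ ≤ ‖T z‖) : T.IsInvertible := by
  have hinj : Function.Injective (T : C3 →ₗ[ℂ] C3) := by
    refine (injective_iff_map_eq_zero _).2 fun z hz => ?_
    have h1 := h z
    rw [show T z = 0 from hz, norm_zero] at h1
    exact norm_le_zero_iff.1 (by nlinarith [norm_nonneg z])
  exact ⟨(LinearEquiv.ofInjectiveEndo _ hinj).toContinuousLinearEquiv, by ext; rfl⟩

/-- Inversion is continuous on the open set of units and takes the default value `0` off it. -/
lemma measurable_tensor_inverse : Measurable (ContinuousLinearMap.inverse : Tensor3 → Tensor3) := by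
  classical
  have ho : IsOpen {T : Tensor3 | IsUnit T} := Units.isOpen
  have hcont : ContinuousOn (Ring.inverse : Tensor3 → Tensor3) {T | IsUnit T} := by
    rintro T ⟨U, rfl⟩
    exact (NormedRing.inverse_continuousAt U).continuousWithinAt
  have hm := hcont.measurable_piecewise (g := fun _ => 0) continuousOn_const ho.measurableSet
  convert hm using 1
  ext1 T
  rw [← ContinuousLinearMap.ringInverse_eq_inverse]
  by_cases hT : IsUnit T
  · rw [Set.piecewise_eq_of_mem _ _ _ (show T ∈ {T : Tensor3 | IsUnit T} from hT)]
  · rw [Set.piecewise_eq_of_notMem _ _ _ (show T ∉ {T : Tensor3 | IsUnit T} from hT),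
      Ring.inverse_non_unit _ hT]

/-! ### Elliptic fields on `Ω` and their inverses. -/

namespace LipschitzDomain

variable {Ω : LipschitzDomain} {μ : R3 → Tensor3} {θ c : ℝ}

lemma EllipticWith.ae_mul_norm_le (h : Ω.EllipticWith μ θ c) :
    ∀ᵐ x ∂Ω.vol, (μ x).IsInvertible ∧ ∀ z, c * ‖z‖ ≤ ‖μ x z‖ := by
  filter_upwards [h.2] with x hx
  have := mul_norm_le_of_elliptic hx
  exact ⟨isInvertible_of_mul_norm_le h.1 this, this⟩

lemma EllipticWith.memLp_inverse (h : Ω.EllipticWith μ θ c) (hμ : MemLp μ ⊤ Ω.vol) :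
    MemLp (fun x => (μ x).inverse) ⊤ Ω.vol := by
  refine memLp_top_of_bound
    (measurable_tensor_inverse.comp_aemeasurable hμ.1.aemeasurable).aestronglyMeasurable c⁻¹ ?_
  filter_upwards [h.ae_mul_norm_le] with x hx
  refine ContinuousLinearMap.opNorm_le_bound _ (inv_nonneg.2 h.1.le) fun w => ?_
  have h1 := hx.2 ((μ x).inverse w)
  rw [hx.1.self_apply_inverse] at h1
  rwa [inv_mul_eq_div, le_div_iff₀ h.1, mul_comm]

lemma ae_norm_le_supNorm (hμ : MemLp μ ⊤ Ω.vol) : ∀ᵐ x ∂Ω.vol, ‖μ x‖ ≤ Ω.supNorm μ :=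
  ae_norm_le_toReal_eLpNorm_top hμ

/-- Lets an almost-everywhere property be evaluated at some point, as the positivity of `μ₊`
requires. -/
instance : NeZero Ω.vol :=
  ⟨fun h => (Ω.isOpen.measure_pos volume Ω.isConnected.nonempty).ne'
    (Measure.restrict_eq_zero.1 h)⟩

lemma EllipticWith.supNorm_pos (h : Ω.EllipticWith μ θ c) (hμ : MemLp μ ⊤ Ω.vol) :
    0 < Ω.supNorm μ := by
  obtain ⟨x, h1, h2⟩ := (h.ae_mul_norm_le.and (ae_norm_le_supNorm hμ)).exists
  have h3 := h1.2 (EuclideanSpace.single 0 1)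
  have h4 := (μ x).le_of_opNorm_le h2 (EuclideanSpace.single 0 1)
  simp only [PiLp.norm_single, norm_one, mul_one] at h3 h4
  linarith [h.1]

/-- If `-μ⁻¹` is elliptic in the direction `θ`, then `μ` is elliptic in the direction `π - θ`. -/
lemma EllipticWith.of_neg_inverse {θ' c' : ℝ} (h' : Ω.EllipticWith μ θ' c')
    (h : Ω.EllipticWith (fun x => -(μ x).inverse) θ c) :
    Ω.EllipticWith μ (Real.pi - θ) (c * c' ^ 2) := by
  refine ⟨mul_pos h.1 (pow_pos h'.1 2), ?_⟩
  filter_upwards [h.2, h'.ae_mul_norm_le] with x hx hx' z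
  -- Test the ellipticity of `-μ⁻¹` on `μ z`; then `c |μ z|² ≥ c c'² |z|²`.
  have h1 := hx (μ x z)
  rw [neg_apply, hx'.1.inverse_apply_self, re_exp_mul_inner_neg_swap] at h1
  refine le_trans ?_ h1
  rw [mul_assoc, ← mul_pow]
  exact mul_le_mul_of_nonneg_left
    (pow_le_pow_left₀ (mul_nonneg h'.1.le (norm_nonneg z)) (hx'.2 z) 2) h.1.le

/-- If `μ` is elliptic in the direction `π - θ`, then `-μ⁻¹` is elliptic in the direction `θ`. -/
lemma EllipticWith.neg_inverse (h : Ω.EllipticWith μ (Real.pi - θ) c) (hμ : MemLp μ ⊤ Ω.vol) :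
    Ω.EllipticWith (fun x => -(μ x).inverse) θ (c / Ω.supNorm μ ^ 2) := by
  have hs := h.supNorm_pos hμ
  refine ⟨div_pos h.1 (pow_pos hs 2), ?_⟩
  filter_upwards [h.2, h.ae_mul_norm_le, ae_norm_le_supNorm hμ] with x hx hx' hb w
  -- Test the ellipticity of `μ` on `μ⁻¹ w`, for which `|w| ≤ μ₊ |μ⁻¹ w|`.
  have h1 := hx ((μ x).inverse w)
  have h2 := (μ x).le_of_opNorm_le hb ((μ x).inverse w)
  rw [hx'.1.self_apply_inverse] at h1 h2
  rw [neg_apply, re_exp_mul_inner_neg_swap]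
  refine le_trans ?_ h1
  rw [div_mul_eq_mul_div, div_le_iff₀ (pow_pos hs 2), mul_assoc, ← mul_pow, mul_comm ‖_‖]
  exact mul_le_mul_of_nonneg_left (pow_le_pow_left₀ (norm_nonneg w) h2 2) h.1.le

/-! ### The Robin form and its coercivity. -/

lemma hPlusNorm_sq (u : Ω.HPlus) :
    Ω.hPlusNorm u ^ 2 = ‖u.1.1‖ ^ 2 + ‖Ω.curl u.1‖ ^ 2 + ‖Ω.tangentialTrace u‖ ^ 2 :=
  Real.sq_sqrt (by positivity)

lemma isSesquilinear_robinForm {ω : ℝ} {ε α : R3 → Tensor3}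
    (hμ : MemLp (fun x => (μ x).inverse) ⊤ Ω.vol) (hε : MemLp ε ⊤ Ω.vol)
    (hα : MemLp α ⊤ Ω.surfaceMeasure) : IsSesquilinear (Ω.robinForm ω ε μ α) := by
  have hM := isSesquilinear_tensor hμ
  have hE := isSesquilinear_tensor hε
  have hA := isSesquilinear_tensor hα
  constructor
  · intro u u' v
    simp only [robinForm, map_add, Submodule.coe_add, hM.add_left, hE.add_left, hA.add_left]
    ring
  · intro k u v
    simp only [robinForm, map_smul, Submodule.coe_smul, hM.smul_left, hE.smul_left, hA.smul_left]
    ring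
  · intro u v v'
    simp only [robinForm, map_add, Submodule.coe_add, hM.add_right, hE.add_right, hA.add_right]
    ring
  · intro k u v
    simp only [robinForm, map_smul, Submodule.coe_smul, hM.smul_right, hE.smul_right,
      hA.smul_right]
    ring

end LipschitzDomain

theorem mainTheorem2 (Ω : LipschitzDomain) (ω : ℝ) (hω : 0 < ω) (ε μ α : R3 → Tensor3)
    (hε : Ω.IsElliptic ε) (hμ : Ω.IsElliptic μ) (hα : Ω.IsTangentialTensorField α)
    (θ : ℝ)
    (hθε : Ω.IsEllipticityDirection ε θ)
    (hθμ : Ω.IsEllipticityDirection (fun x => -(μ x).inverse) θ)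
    (hθα : Ω.IsTangentialEllipticityDirection α θ) :
    (∃ εm μm αm : ℝ, Ω.EllipticWith ε θ εm ∧ Ω.EllipticWith μ (Real.pi - θ) μm ∧
      Ω.TangentialEllipticWith α θ αm) ∧
    ∀ εm μm αm : ℝ, Ω.EllipticWith ε θ εm → Ω.EllipticWith μ (Real.pi - θ) μm →
      Ω.TangentialEllipticWith α θ αm →
      IsCoerciveWith Ω.hPlusNorm (Ω.robinForm ω ε μ α) θ
        (min (μm / Ω.supNorm μ ^ 2) (min (ω ^ 2 * εm) αm)) := by
  obtain ⟨ce, hce⟩ := hθε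
  obtain ⟨cm, hcm⟩ := hθμ
  obtain ⟨ca, hca⟩ := hθα
  -- The direction `θ'` need not be `π - θ`: only the lower bound `c' |z| ≤ |μ z|` and the
  -- invertibility it implies are used.
  obtain ⟨hμb, θ', c', hμe⟩ := hμ
  refine ⟨⟨ce, cm * c' ^ 2, ca, hce, hμe.of_neg_inverse hcm, hca⟩, ?_⟩
  intro εm μm αm hεm hμm hαm
  have hi := hμm.memLp_inverse hμb
  have hn := hμm.neg_inverse hμb
  refine ⟨LipschitzDomain.isSesquilinear_robinForm hi hε.1 hα.1,
    lt_min hn.1 (lt_min (mul_pos (pow_pos hω 2) hεm.1) hαm.1), fun u => ?_⟩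
  set C := min (μm / Ω.supNorm μ ^ 2) (min (ω ^ 2 * εm) αm) with hC
  have hC1 : C ≤ μm / Ω.supNorm μ ^ 2 := min_le_left _ _
  have hC2 : C ≤ ω ^ 2 * εm := (min_le_right _ _).trans (min_le_left _ _)
  have hC3 : C ≤ αm := (min_le_right _ _).trans (min_le_right _ _)
  -- The form contains `μ⁻¹`, so the sign of `-μ⁻¹` is moved into the scalar.
  have h1 := mul_norm_sq_le_re_integral_tensor hi (Ω.curl u.1) (-Complex.exp (Complex.I * θ))
    (μm / Ω.supNorm μ ^ 2) (by
      filter_upwards [hn.2] with x hx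
      simpa [inner_neg_right] using hx (Ω.curl u.1 x))
  have h2 := mul_norm_sq_le_re_integral_tensor hε.1 u.1.1 (Complex.exp (Complex.I * θ)) εm (by
    filter_upwards [hεm.2] with x hx using hx _)
  -- The trace is tangent almost everywhere, so the ellipticity of `α` applies to its values.
  have h3 := mul_norm_sq_le_re_integral_tensor hα.1 (Ω.tangentialTrace u).1
    (Complex.exp (Complex.I * θ)) αm (by
      filter_upwards [hαm.2, (Ω.tangentialTrace u).2] with x hx ht using hx _ ht)
  rw [LipschitzDomain.hPlusNorm_sq, LipschitzDomain.robinForm]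
  generalize ∫ x, inner ℂ (Ω.curl u.1 x) ((μ x).inverse (Ω.curl u.1 x)) ∂Ω.vol = I₁ at *
  generalize ∫ x, inner ℂ (u.1.1 x) (ε x (u.1.1 x)) ∂Ω.vol = I₂ at *
  generalize ∫ x, inner ℂ ((Ω.tangentialTrace u).1 x) (α x ((Ω.tangentialTrace u).1 x))
    ∂Ω.surfaceMeasure = I₃ at *
  have hsplit : (-(Complex.exp (Complex.I * θ) * (I₁ - (ω : ℂ) ^ 2 * I₂ - I₃))).re =
      (-Complex.exp (Complex.I * θ) * I₁).re + ω ^ 2 * (Complex.exp (Complex.I * θ) * I₂).re +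
        (Complex.exp (Complex.I * θ) * I₃).re := by
    rw [← Complex.re_ofReal_mul, ← Complex.add_re, ← Complex.add_re]
    congr 1
    push_cast
    ring
  rw [hsplit]
  have e1 := mul_le_mul_of_nonneg_right hC1 (sq_nonneg ‖Ω.curl u.1‖)
  have e2 := mul_le_mul_of_nonneg_right hC2 (sq_nonneg ‖u.1.1‖)
  have e3 := mul_le_mul_of_nonneg_right hC3 (sq_nonneg ‖Ω.tangentialTrace u‖)
  have e4 := mul_le_mul_of_nonneg_left h2 (sq_nonneg ω)
  rw [Submodule.norm_coe] at h3
  linarith
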